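/- **Setting.** There are $n$ agents $1,\dots,n$ and $m$ groups $1,\dots,m$; group $j$ has a fixed weight $w_j>0$, and $w_{\max}=\max_j w_j$, $w_{\min}=\min_j w_j$. The type of agent $i$ is $\theta_i=(x_i,g_i)$, where $x_i\in\mathbb R$ is her (private) location and $g_i\subseteq\{1,\dots,m\}$ is the (public) set of groups she belongs to; $\Theta$ is the set of all types. A deterministic two-facility mechanism is a map $f:\Theta^n\to\mathbb R^2$. For facility locations $y=(y_1,y_2)$ the cost of an agent at $x$ is $c(y,x)=\min_{l\in\{1,2\}}|y_l-x|$. The mechanism $f$ is strategyproof if, for every profile $\theta\in\Theta^n$, every agent $i$ and every $x_i'\in\mathbb R$, $$c(f(\theta),x_i)\le c\bigl(f((x_i',g_i),\theta_{-i}),x_i\bigr).$$ For a profile $\theta$ and $y\in\mathbb R^2$ put $$\mathrm{MGE}(\theta,y)=\max_{1\le j\le m}\; w_j\sum_{i:\,j\in g_i}c(y,x_i),$$ and let the approximation ratio of $f$ be $$\rho(f)=\sup_{\theta\in\Theta^n}\frac{\mathrm{MGE}(\theta,f(\theta))}{\min_{y\in\mathbb R^2}\mathrm{MGE}(\theta,y)}\in[0,\infty],$$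 where $a/0=\infty$ for $a>0$, and profiles of the form $0/0$ are disregarded. **Proposition.** Let $n\ge 5$ and $m\ge 2$. For all weights $w_1,\dots,w_m>0$, every deterministic strategyproof two-facility mechanism $f$ satisfies $$\rho(f)\;\ge\;1+(n-2)\cdot\frac{w_{\max}}{w_{\min}}.$$ -/

import Mathlib

open scoped ENNReal

namespace GroupFacility

/-- The type of an agent: her location on the real line (private) and the set of the groups
among `1, …, m` to which she belongs (public). -/
structure AgentType (m : ℕ) where
  loc : ℝ
  groups : Finset (Fin m)

/-- A type profile of `n` agents and `m` groups. -/
abbrev Profile (n m : ℕ) : Type := Fin n → AgentType m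

/-- A deterministic mechanism for `k` facilities: a map from type profiles to `k` points of the
real line. -/
abbrev Mechanism (n m k : ℕ) : Type := Profile n m → (Fin k → ℝ)

/-- The cost of an agent at `x` under the facility locations `y`: the distance from `x` to the
nearest facility (meant for `1 ≤ k`). -/
noncomputable def cost {k : ℕ} (y : Fin k → ℝ) (x : ℝ) : ℝ :=
  ⨅ l : Fin k, |y l - x|

/-- Strategyproofness: no agent can lower her cost by misreporting her location. -/
def Strategyproof {n m k : ℕ} (f : Mechanism n m k) : Prop :=
  ∀ (θ : Profile n m) (i : Fin n) (x' : ℝ),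
    cost (f θ) (θ i).loc ≤
      cost (f (Function.update θ i ⟨x', (θ i).groups⟩)) (θ i).loc

/-- The weighted total group cost of group `j`: its weight times the sum of the costs of its
members. -/
noncomputable def weightedTotalGroupCost {n m k : ℕ} (w : Fin m → ℝ) (θ : Profile n m)
    (y : Fin k → ℝ) (j : Fin m) : ℝ :=
  w j * ∑ i : Fin n with j ∈ (θ i).groups, cost y (θ i).loc

/-- The maximum group effect: the largest weighted total group cost of a group. -/
noncomputable def maxGroupEffect {n m k : ℕ} (w : Fin m → ℝ) (θ : Profile n m)
    (y : Fin k → ℝ) : ℝ :=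
  ⨆ j : Fin m, weightedTotalGroupCost w θ y j

/-- The optimal maximum group effect over all placements of `k` facilities. -/
noncomputable def optMaxGroupEffect {n m : ℕ} (k : ℕ) (w : Fin m → ℝ) (θ : Profile n m) : ℝ :=
  ⨅ y : Fin k → ℝ, maxGroupEffect w θ y

/-- The approximation ratio of a mechanism: the supremum over all type profiles of the ratio of
the maximum group effect of the mechanism to the optimal one, as an extended nonnegative real.
Here `a / 0 = ∞` for `a > 0`, and profiles with ratio `0 / 0` contribute `0`. -/
noncomputable def approxRatio {n m k : ℕ} (w : Fin m → ℝ) (f : Mechanism n m k) : ℝ≥0∞ :=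
  ⨆ θ : Profile n m,
    ENNReal.ofReal (maxGroupEffect w θ (f θ)) / ENNReal.ofReal (optMaxGroupEffect k w θ)

/-- The largest group weight. -/
noncomputable def wMax {m : ℕ} (w : Fin m → ℝ) : ℝ := ⨆ j : Fin m, w j

/-- The smallest group weight. -/
noncomputable def wMin {m : ℕ} (w : Fin m → ℝ) : ℝ := ⨅ j : Fin m, w j

end GroupFacility

/-! Put one agent `o` alone in a group of minimal weight and everybody else in a different group of
maximal weight. A ratio below the bound has two consequences. Costs are at most `K * δ` whenever two
points are within `δ` of all agents (`clusterBounded_twoGroupProfile`). With `o` at a, one agent at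
t and the other n - 2 at c ≠ a, some facility is strictly closer to c than a is
(`cost_lt_of_ratio_lt`). `Truthful.false_of_cost_lt` refutes this pair.

Keep `o` to the left of everybody. Strictness forces the n - 2 agents at c to be served exactly.
`FourPlayerRule.mem_of_agree` then allows agents to change over from c to t one at a time, so for
every split of the others into two clusters each cluster is served. If the two clusters are close
together but distinct, they use up both facilities, and the distant `o` violates the cost bound.

The recurring tool is the set of options of a truthful agent or coalition: the locations served when
reported. An endpoint of a gap between options is also chosen by reports just inside the gap. Moving
other agents onto that facility keeps it, until three distinct facilities are needed. -/

namespace GroupFacility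

/-! ### Costs under two facilities -/

section TwoFacilities

variable {Y : Fin 2 → ℝ} {x y z : ℝ}

lemma cost_le_of_mem (hy : y ∈ Set.range Y) (x : ℝ) : cost Y x ≤ |y - x| := by
  obtain ⟨l, rfl⟩ := hy
  exact ciInf_le (Set.finite_range fun l => |Y l - x|).bddBelow l

lemma exists_mem_cost_eq (Y : Fin 2 → ℝ) (x : ℝ) : ∃ y ∈ Set.range Y, |y - x| = cost Y x := by
  obtain ⟨l, hl⟩ := exists_eq_ciInf_of_finite (f := fun l => |Y l - x|)
  exact ⟨Y l, ⟨l, rfl⟩, hl⟩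

lemma cost_nonneg (Y : Fin 2 → ℝ) (x : ℝ) : 0 ≤ cost Y x := by
  obtain ⟨y, -, hy⟩ := exists_mem_cost_eq Y x
  rw [← hy]
  exact abs_nonneg _

lemma cost_eq_zero_of_mem (hy : y ∈ Set.range Y) : cost Y y = 0 :=
  le_antisymm (by simpa using cost_le_of_mem hy y) (cost_nonneg Y y)

lemma mem_of_cost_le_zero (h : cost Y x ≤ 0) : x ∈ Set.range Y := by
  obtain ⟨y, hy, hyx⟩ := exists_mem_cost_eq Y x
  have : y = x := by
    have := abs_nonneg (y - x)
    exact sub_eq_zero.1 (abs_eq_zero.1 (by linarith))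
  exact this ▸ hy

/-- Pigeonhole; most contradictions below exhibit three distinct facilities. -/
lemma eq_or_eq_or_eq_of_mem (hx : x ∈ Set.range Y) (hy : y ∈ Set.range Y)
    (hz : z ∈ Set.range Y) : x = y ∨ x = z ∨ y = z := by
  obtain ⟨i, rfl⟩ := hx
  obtain ⟨j, rfl⟩ := hy
  obtain ⟨k, rfl⟩ := hz
  fin_cases i <;> fin_cases j <;> fin_cases k <;> simp

end TwoFacilities

/-! ### Options of a single truthful agent -/

/-- A family of outcomes indexed by the report of one agent, in which truth-telling is optimal. -/
def IsTruthful (φ : ℝ → Fin 2 → ℝ) : Prop :=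
  ∀ x x', cost (φ x) x ≤ cost (φ x') x

namespace IsTruthful

variable {φ : ℝ → Fin 2 → ℝ}

/-- An agent at `y` could report `x` and pay nothing. Later this moves agents onto a facility
without losing it. -/
lemma mem_self (h : IsTruthful φ) {x y : ℝ} (hy : y ∈ Set.range (φ x)) :
    y ∈ Set.range (φ y) :=
  mem_of_cost_le_zero ((h y x).trans_eq (cost_eq_zero_of_mem hy))

lemma neg (h : IsTruthful φ) : IsTruthful fun x => -φ (-x) := by
  have key : ∀ (Y : Fin 2 → ℝ) (x : ℝ), cost (-Y) x = cost Y (-x) := by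
    intro Y x
    unfold cost
    congr 1
    ext l
    rw [← abs_neg]
    congr 1
    simp only [Pi.neg_apply]
    ring
  intro x x'
  simp only [key]
  exact h _ _

/-- Imitating a report at distance d costs at most d extra, so the function is 1-Lipschitz. Hence
the set of options is closed. -/
lemma continuous_cost (h : IsTruthful φ) : Continuous fun x => cost (φ x) x := by
  have key : ∀ x x', cost (φ x) x ≤ cost (φ x') x' + |x - x'| := by
    intro x x'
    obtain ⟨y, hy, hyx⟩ := exists_mem_cost_eq (φ x') x'
    have h1 := cost_le_of_mem hy x
    have h2 := abs_sub_le y x' x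
    rw [abs_sub_comm x' x] at h2
    have := h x x'
    linarith
  refine (LipschitzWith.of_dist_le_mul (K := 1) fun x x' => ?_).continuous
  rw [Real.dist_eq, Real.dist_eq, NNReal.coe_one, one_mul, abs_sub_le_iff]
  have h1 := key x x'
  have h2 := key x' x
  rw [abs_sub_comm] at h2
  constructor <;> linarith

/-- If `v` is not an option, then the next option `r` to its right is chosen by the reports
slightly to the left of `r`. -/
lemma exists_right_option (h : IsTruthful φ) {v u : ℝ} (hv : v ∉ Set.range (φ v))
    (hu : u ∈ Set.range (φ u)) (hvu : v < u) :
    ∃ r, v < r ∧ r ≤ u ∧ ∀ δ > 0, ∃ η, 0 < η ∧ η < δ ∧ r ∈ Set.range (φ (r - η)) := by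
  set S : Set ℝ := {s | v ≤ s ∧ cost (φ s) s ≤ 0} with hS
  have hclosed : IsClosed S :=
    (isClosed_le continuous_const continuous_id).inter
      (isClosed_le h.continuous_cost continuous_const)
  have huS : u ∈ S := ⟨hvu.le, (cost_eq_zero_of_mem hu).le⟩
  have hbdd : BddBelow S := ⟨v, fun s hs => hs.1⟩
  have hr : sInf S ∈ S := hclosed.csInf_mem ⟨u, huS⟩ hbdd
  set r := sInf S with hrdef
  have hrmem : r ∈ Set.range (φ r) := mem_of_cost_le_zero hr.2
  have hvr : v < r := by
    rcases hr.1.lt_or_eq with hlt | heq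
    · exact hlt
    · exact absurd (heq ▸ hrmem) hv
  refine ⟨r, hvr, csInf_le hbdd huS, fun δ hδ => ?_⟩
  have hm : 0 < min (δ / 2) ((r - v) / 2) := lt_min (by linarith) (by linarith)
  refine ⟨min (δ / 2) ((r - v) / 2), hm, (min_le_left _ _).trans_lt (by linarith), ?_⟩
  set η := min (δ / 2) ((r - v) / 2)
  have hη : η ≤ (r - v) / 2 := min_le_right _ _
  obtain ⟨y, hy, hyc⟩ := exists_mem_cost_eq (φ (r - η)) (r - η)
  -- The facility nearest to `r - η` lies in `[r - 2 * η, r]`, which is within `[v, r]`; it is an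
  -- option, so it can only be `r`.
  have h1 : |y - (r - η)| ≤ η := by
    rw [hyc]
    refine (h _ r).trans ((cost_le_of_mem hrmem _).trans_eq ?_)
    rw [sub_sub_cancel, abs_of_pos hm]
  rw [abs_le] at h1
  have hyS : y ∈ S := ⟨by linarith, (cost_eq_zero_of_mem (h.mem_self hy)).le⟩
  have h2 : r ≤ y := csInf_le hbdd hyS
  have : y = r := by linarith
  exact this ▸ hy

/-- If `v` is not an option, then the next option `l` to its left is chosen by the reports
slightly to the right of `l`. -/
lemma exists_left_option (h : IsTruthful φ) {v u : ℝ} (hv : v ∉ Set.range (φ v))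
    (hu : u ∈ Set.range (φ u)) (huv : u < v) :
    ∃ l, u ≤ l ∧ l < v ∧ ∀ δ > 0, ∃ η, 0 < η ∧ η < δ ∧ l ∈ Set.range (φ (l + η)) := by
  have key : ∀ (Y : Fin 2 → ℝ) (y : ℝ), y ∈ Set.range (-Y) ↔ -y ∈ Set.range Y := by
    intro Y y
    simp only [Set.mem_range, Pi.neg_apply]
    exact exists_congr fun l => neg_eq_iff_eq_neg
  obtain ⟨r, h1, h2, h3⟩ := h.neg.exists_right_option (v := -v) (u := -u)
    (by simpa [key] using hv) (by simpa [key] using hu) (by linarith)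
  refine ⟨-r, by linarith, by linarith, fun δ hδ => ?_⟩
  obtain ⟨η, h4, h5, h6⟩ := h3 δ hδ
  refine ⟨η, h4, h5, ?_⟩
  have := (key _ _).1 h6
  rwa [neg_sub, sub_eq_neg_add] at this

end IsTruthful

/-! ### Four-player rules -/

/-- A truthful rule for four players all of whose costs are at most `K * δ` whenever two points
are within `δ` of all the players. -/
structure FourPlayerRule (K : ℝ) (G : ℝ → ℝ → ℝ → ℝ → Fin 2 → ℝ) : Prop where
  truthful₁ : ∀ q w v, IsTruthful fun a => G a q w v
  truthful₂ : ∀ a w v, IsTruthful fun q => G a q w v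
  truthful₃ : ∀ a q v, IsTruthful fun w => G a q w v
  truthful₄ : ∀ a q w, IsTruthful fun v => G a q w v
  bounded : ∀ a q w v p p' δ, (|a - p| ≤ δ ∨ |a - p'| ≤ δ) → (|q - p| ≤ δ ∨ |q - p'| ≤ δ) →
    (|w - p| ≤ δ ∨ |w - p'| ≤ δ) → (|v - p| ≤ δ ∨ |v - p'| ≤ δ) →
    cost (G a q w v) a ≤ K * δ ∧ cost (G a q w v) q ≤ K * δ ∧ cost (G a q w v) v ≤ K * δ

namespace FourPlayerRule

variable {K : ℝ} {G : ℝ → ℝ → ℝ → ℝ → Fin 2 → ℝ}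

/-- To the right of `a < q`, players three and four at nearby points `v ≤ w` share a facility
between them, while the other facility stays away. -/
lemma exists_shared (hG : FourPlayerRule K G) (hK : 0 ≤ K)
    (h₃ : ∀ a q v, a < q → a < v → v ∈ Set.range (G a q v v))
    {a q w v : ℝ} (haq : a < q) (hvw : v ≤ w) (hclose : (K + 1) * (w - v) < v - q) :
    ∃ y z, y ∈ Set.range (G a q w v) ∧ z ∈ Set.range (G a q w v) ∧ v ≤ y ∧ y ≤ w ∧
      z ≤ q + K * (w - v) := by
  have hKd : 0 ≤ K * (w - v) := mul_nonneg hK (by linarith)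
  have hqv : q < v := by nlinarith
  have hcv : cost (G a q w v) v ≤ w - v := by
    refine (hG.truthful₄ a q w v w).trans
      ((cost_le_of_mem (h₃ a q w haq (by linarith)) v).trans_eq ?_)
    rw [abs_of_nonneg (by linarith)]
  have hcw : cost (G a q w v) w ≤ w - v := by
    refine (hG.truthful₃ a q v w v).trans
      ((cost_le_of_mem (h₃ a q v haq (by linarith)) w).trans_eq ?_)
    rw [abs_sub_comm, abs_of_nonneg (by linarith)]
  -- If player one joined player two at `q`, boundedness would put a facility near `q`; not
  -- deviating must be at least as good for her.
  obtain ⟨z, hz, hza⟩ : ∃ z ∈ Set.range (G a q w v), z ≤ q + K * (w - v) := by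
    obtain ⟨s, hs, hsc⟩ := exists_mem_cost_eq (G q q w v) q
    have h1 := (hG.bounded q q w v q v (w - v) (by simp [hvw]) (by simp [hvw])
      (Or.inr (abs_of_nonneg (by linarith)).le) (by simp [hvw])).1
    rw [← hsc, abs_le] at h1
    obtain ⟨z, hz, hzc⟩ := exists_mem_cost_eq (G a q w v) a
    have h2 : cost (G a q w v) a ≤ |s - a| :=
      (hG.truthful₁ q w v a q).trans (cost_le_of_mem hs a)
    have h3 : |s - a| ≤ q - a + K * (w - v) := abs_le.2 ⟨by linarith, by linarith⟩
    rw [← hzc] at h2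
    have h4 := le_abs_self (z - a)
    exact ⟨z, hz, by linarith⟩
  obtain ⟨y, hy, hyc⟩ := exists_mem_cost_eq (G a q w v) v
  obtain ⟨y', hy', hyc'⟩ := exists_mem_cost_eq (G a q w v) w
  rw [← hyc, abs_le] at hcv
  rw [← hyc', abs_le] at hcw
  have hyy : y = y' := by
    rcases eq_or_eq_or_eq_of_mem hy hy' hz with h | h | h
    · exact h
    · exfalso; linarith
    · exfalso; linarith
  exact ⟨y, z, hy, hz, by linarith, by linarith, by linarith⟩

/-- Moving player three slightly to the right must not benefit her at `w₁`. This pins the shared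
facility at the leftmost admissible `v`, and the absence of gaps between options gives the rest. -/
lemma mem_step (hG : FourPlayerRule K G) (hK : 0 ≤ K)
    (h₃ : ∀ a q v, a < q → a < v → v ∈ Set.range (G a q v v))
    {a q w₁ w₂ : ℝ} (haq : a < q) (hw : w₁ < w₂)
    (hstep : 2 * (K + 3) * (w₂ - w₁) < w₂ - q)
    (h : ∀ v, v ≤ w₁ → (K + 2) * (w₁ - v) ≤ v - q → q < v → v ∈ Set.range (G a q w₁ v)) :
    ∀ v, v ≤ w₂ → (K + 2) * (w₂ - v) ≤ v - q → q < v → v ∈ Set.range (G a q w₂ v) := by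
  have hlt : ∀ {w v : ℝ}, v ≤ w → (K + 2) * (w - v) ≤ v - q → q < v →
      (K + 1) * (w - v) < v - q := by
    intro w v h1 h2 h3
    rcases h1.lt_or_eq with h4 | h4
    · nlinarith
    · subst h4; simpa using h3
  -- The leftmost admissible position of player four: equality in `(K + 2) * (w₂ - v) ≤ v - q`.
  set u := ((K + 2) * w₂ + q) / (K + 3) with hu
  have hK3 : 0 < K + 3 := by linarith
  have hueq : (K + 3) * u = (K + 2) * w₂ + q := by rw [hu]; field_simp
  have huw : u < w₁ := by nlinarith
  have hqu : q < u := by nlinarith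
  have hu2 : (K + 2) * (w₂ - u) = u - q := by linarith
  have humem : u ∈ Set.range (G a q w₂ u) := by
    obtain ⟨y, z, hy, hz, h1, h2, h3⟩ :=
      hG.exists_shared hK h₃ haq (by linarith) (hlt (by linarith) hu2.le hqu)
    have hcl := hlt huw.le (by nlinarith) hqu
    obtain ⟨y', z', hy', hz', h1', h2', h3'⟩ := hG.exists_shared hK h₃ haq huw.le hcl
    have hmem := h u huw.le (by nlinarith) hqu
    have hu' : y' = u := by
      rcases eq_or_eq_or_eq_of_mem hy' hz' hmem with h | h | h
      · exfalso; linarith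
      · exact h
      · exfalso; linarith
    have hc : cost (G a q w₁ u) w₁ = w₁ - u := by
      obtain ⟨s, hs, hsc⟩ := exists_mem_cost_eq (G a q w₁ u) w₁
      have hle := cost_le_of_mem hmem w₁
      rw [abs_sub_comm, abs_of_pos (by linarith)] at hle
      have : s = u ∨ s = z' := by
        rcases eq_or_eq_or_eq_of_mem hs hmem hz' with h | h | h
        · exact Or.inl h
        · exact Or.inr h
        · exfalso; linarith
      rcases this with rfl | rfl
      · rw [← hsc, abs_sub_comm, abs_of_pos (by linarith)]
      · rw [← hsc, abs_sub_comm, abs_of_pos (by linarith)] at hle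
        linarith
    have hdev := (hG.truthful₃ a q u w₁ w₂).trans (cost_le_of_mem hy w₁)
    simp only [hc] at hdev
    -- By `hstep`, `w₁` is past the midpoint of `u` and `w₂`, so a facility at distance at least `w₁
    -- - u` to its right would exceed `w₂`.
    have : y ≤ u := by
      rcases le_abs.1 hdev with h | h
      · nlinarith
      · linarith
    have hyu : y = u := le_antisymm this h1
    exact hyu ▸ hy
  intro v hv hv2 hqv
  by_contra hvmem
  have huv : u ≤ v := by nlinarith
  have huv' : u < v := huv.lt_of_ne fun h => hvmem (h ▸ humem)
  obtain ⟨l, hl1, hl2, hl3⟩ := (hG.truthful₄ a q w₂).exists_left_option hvmem humem huv'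
  obtain ⟨η, hη, hη', hmem⟩ := hl3 (v - l) (by linarith)
  have h4 : (K + 2) * (w₂ - (l + η)) ≤ l + η - q := by nlinarith
  obtain ⟨y, z, hy, hz, h1, h2, h3⟩ :=
    hG.exists_shared hK h₃ haq (w := w₂) (v := l + η) (by linarith)
      (hlt (by linarith) h4 (by linarith))
  have h5 : K * (w₂ - (l + η)) ≤ K * (w₂ - u) := mul_le_mul_of_nonneg_left (by linarith) hK
  rcases eq_or_eq_or_eq_of_mem hmem hy hz with h | h | h <;> linarith

/-- To the right of `a < q`, player four at a point `v` slightly to the left of player three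
is served exactly. -/
lemma mem_of_lt (hG : FourPlayerRule K G) (hK : 0 ≤ K)
    (h₃ : ∀ a q v, a < q → a < v → v ∈ Set.range (G a q v v))
    (h₂ : ∀ a w v, a < w → a < v → v ∈ Set.range (G a v w v))
    {a q w : ℝ} (haq : a < q) (hqw : q < w) :
    ∀ v, v ≤ w → (K + 2) * (w - v) ≤ v - q → q < v → v ∈ Set.range (G a q w v) := by
  -- When `a` is comparatively far, it needs its own facility, so player two uses the shared one.
  -- She could join player four at `v`, which by `h₂` is then served; hence the shared facility is
  -- not to the right of `v`.
  have near : ∀ w, q < w → (K + 1) * (w - q) < q - a →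
      ∀ v, v ≤ w → (K + 2) * (w - v) ≤ v - q → q < v → v ∈ Set.range (G a q w v) := by
    intro w hqw hwa v hvw hv hqv
    have hcl : (K + 1) * (w - v) < v - q := by
      rcases hvw.lt_or_eq with h4 | h4
      · nlinarith
      · subst h4; simpa using hqv
    obtain ⟨y, z, hy, hz, h1, h2, h3⟩ := hG.exists_shared hK h₃ haq hvw hcl
    obtain ⟨s, hs, hsc⟩ := exists_mem_cost_eq (G a q w v) q
    have h4 : cost (G a q w v) q ≤ |v - q| :=
      (hG.truthful₂ a w v q v).trans (cost_le_of_mem (h₂ a w v (by linarith) (by linarith)) q)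
    rw [← hsc, abs_of_pos (a := v - q) (by linarith), abs_le] at h4
    obtain ⟨s', hs', hsc'⟩ := exists_mem_cost_eq (G a q w v) a
    have h5 := (hG.bounded a q w v a q (w - q) (by simp [hqw.le]) (by simp [hqw.le])
      (Or.inr (abs_of_nonneg (by linarith)).le)
      (Or.inr (by rw [abs_of_nonneg (by linarith)]; linarith))).1
    rw [← hsc', abs_le] at h5
    have h6 : s' < s := by linarith
    have : s = y := by
      rcases eq_or_eq_or_eq_of_mem hs hs' hy with h | h | h
      · exfalso; linarith
      · exact h
      · exfalso; linarith
    have : y = v := by linarith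
    exact this ▸ hy
  -- Growing `w - q` by the factor `1 + s` meets the step condition of `mem_step`; `ε` below is a
  -- scale at which `near` applies.
  set s : ℝ := 1 / (2 * (K + 3)) with hs
  have hs0 : 0 < s := by positivity
  have hsK : 2 * (K + 3) * s = 1 := by rw [hs]; field_simp
  set ε := (q - a) / (K + 2) with hε
  have hε0 : 0 < ε := div_pos (by linarith) (by linarith)
  have hεK : (K + 2) * ε = q - a := by rw [hε]; field_simp
  have iter : ∀ (k : ℕ) (w : ℝ), q < w → w - q ≤ (1 + s) ^ k * ε →
      ∀ v, v ≤ w → (K + 2) * (w - v) ≤ v - q → q < v → v ∈ Set.range (G a q w v) := by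
    intro k
    induction k with
    | zero =>
      intro w hqw hw
      refine near w hqw ?_
      rw [pow_zero, one_mul] at hw
      nlinarith
    | succ k ih =>
      intro w hqw hw
      set w₁ := q + (w - q) / (1 + s) with hw₁
      have hd : (1 + s) * (w₁ - q) = w - q := by rw [hw₁]; field_simp; ring
      have h1 : q < w₁ := by nlinarith
      have h2 : w - w₁ = s * (w₁ - q) := by linarith
      have h3 : 0 < s * (w₁ - q) := mul_pos hs0 (by linarith)
      refine hG.mem_step hK h₃ haq (by linarith) ?_ (ih w₁ h1 ?_)
      · rw [h2, ← mul_assoc, hsK]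
        linarith
      · rw [pow_succ] at hw
        have : (1 + s) * (w₁ - q) ≤ (1 + s) * ((1 + s) ^ k * ε) := by rw [hd]; linarith
        exact le_of_mul_le_mul_left this (by linarith)
  obtain ⟨k, hk⟩ := pow_unbounded_of_one_lt ((w - q) / ε) (by linarith : 1 < 1 + s)
  exact iter k w hqw ((div_lt_iff₀ hε0).1 hk).le

/-- Otherwise take the next option `r` on the right and move player three there: `r`, the nearby
player four (by `mem_of_lt`) and the players further left need three facilities. -/
lemma mem_of_lt_of_lt (hG : FourPlayerRule K G) (hK : 0 ≤ K)
    (h₃ : ∀ a q v, a < q → a < v → v ∈ Set.range (G a q v v))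
    (h₂ : ∀ a w v, a < w → a < v → v ∈ Set.range (G a v w v))
    {a t v : ℝ} (hat : a < t) (htv : t < v) : v ∈ Set.range (G a t t v) := by
  by_contra hv
  obtain ⟨u, hu, hvu⟩ : ∃ u, u ∈ Set.range (G a t t u) ∧ v < u := by
    -- Far enough that the facility serving `V` is still to the right of `v`.
    set V := v + K * (t - a) + 1 with hV
    obtain ⟨y, hy, hyc⟩ := exists_mem_cost_eq (G a t t V) V
    have h := (hG.bounded a t t V t V (t - a)
      (Or.inl (by rw [abs_sub_comm, abs_of_pos (by linarith)])) (by simp [hat.le])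
      (by simp [hat.le]) (by simp [hat.le])).2.2
    rw [← hyc, abs_le] at h
    exact ⟨y, (hG.truthful₄ a t t).mem_self hy, by linarith⟩
  obtain ⟨r, hvr, -, hr⟩ := (hG.truthful₄ a t t).exists_right_option hv hu hvu
  obtain ⟨η, hη, hη', hmem⟩ := hr ((r - t) / (K + 3)) (div_pos (by linarith) (by linarith))
  rw [lt_div_iff₀ (by linarith)] at hη'
  replace hmem : r ∈ Set.range (G a t r (r - η)) := (hG.truthful₃ a t (r - η)).mem_self hmem
  have hKη : 0 ≤ K * η := mul_nonneg hK hη.le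
  obtain ⟨y, z, hy, hz, h1, h2, h3⟩ := hG.exists_shared hK h₃ (w := r) (v := r - η) hat
    (by linarith) (by linarith)
  have hmem' := hG.mem_of_lt hK h₃ h₂ hat (by linarith : t < r) (r - η) (by linarith)
    (by linarith) (by linarith)
  rcases eq_or_eq_or_eq_of_mem hmem hmem' hz with h | h | h <;> linarith

/-- Otherwise move players two and three onto the next option `l` on the left: `l`, `l + η` (by
`mem_of_lt_of_lt`) and a facility near `a` are distinct. -/
lemma mem_of_lt_of_lt_of_lt (hG : FourPlayerRule K G) (hK : 0 ≤ K)
    (h₃ : ∀ a q v, a < q → a < v → v ∈ Set.range (G a q v v))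
    (h₂ : ∀ a w v, a < w → a < v → v ∈ Set.range (G a v w v))
    {a q w v : ℝ} (haw : a < w) (hwv : w < v) (hvq : v < q) : v ∈ Set.range (G a q w v) := by
  by_contra hv
  obtain ⟨l, hwl, hlv, hl⟩ := (hG.truthful₄ a q w).exists_left_option hv
    (h₃ a q w (by linarith) haw) hwv
  obtain ⟨η, hη, hη', hmem⟩ := hl ((l - a) / (K + 1)) (div_pos (by linarith) (by linarith))
  rw [lt_div_iff₀ (by linarith)] at hη'
  have hmem₁ : l ∈ Set.range (G a q l (l + η)) := (hG.truthful₃ a q (l + η)).mem_self hmem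
  have hmem₂ : l ∈ Set.range (G a l l (l + η)) := (hG.truthful₂ a l (l + η)).mem_self hmem₁
  have hmem₃ : l + η ∈ Set.range (G a l l (l + η)) :=
    hG.mem_of_lt_of_lt hK h₃ h₂ (by linarith) (by linarith)
  obtain ⟨y, hy, hyc⟩ := exists_mem_cost_eq (G a l l (l + η)) a
  have h := (hG.bounded a l l (l + η) a l η (by simp [hη.le]) (by simp [hη.le])
    (by simp [hη.le]) (by simp [abs_of_pos hη])).1
  rw [← hyc, abs_le] at h
  rcases eq_or_eq_or_eq_of_mem hmem₂ hmem₃ hy with h | h | h <;> linarith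

/-- If player four is served whenever she agrees with player two or with player three, then she
is served whenever those two players agree (all to the right of player one). -/
theorem mem_of_agree (hG : FourPlayerRule K G) (hK : 0 ≤ K)
    (h₃ : ∀ a q v, a < q → a < v → v ∈ Set.range (G a q v v))
    (h₂ : ∀ a w v, a < w → a < v → v ∈ Set.range (G a v w v))
    {a t v : ℝ} (hat : a < t) (hav : a < v) : v ∈ Set.range (G a t t v) := by
  rcases lt_trichotomy t v with htv | rfl | hvt
  · exact hG.mem_of_lt_of_lt hK h₃ h₂ hat htv
  · exact h₃ a t t hat hat
  by_contra hv
  have ha : a ∈ Set.range (G a t t a) := by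
    refine mem_of_cost_le_zero ?_
    simpa using (hG.bounded a t t a a t 0 (by simp) (by simp) (by simp) (by simp)).1
  obtain ⟨l, hal, hlv, hl⟩ := (hG.truthful₄ a t t).exists_left_option hv ha hav
  obtain ⟨η, hη, hη', hmem⟩ := hl ((t - l) / (K + 3)) (div_pos (by linarith) (by linarith))
  rw [lt_div_iff₀ (by linarith)] at hη'
  have hKη : 0 ≤ K * η := mul_nonneg hK hη.le
  -- Players three and one move onto `l`, then player one on to `l - η`. This gives the order
  -- required by `mem_of_lt_of_lt_of_lt`, with a facility at most `l`, one at `l + η` and one near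
  -- `t`.
  have hmem₁ : l ∈ Set.range (G a t l (l + η)) := (hG.truthful₃ a t (l + η)).mem_self hmem
  have hmem₂ : l ∈ Set.range (G l t l (l + η)) := (hG.truthful₁ t l (l + η)).mem_self hmem₁
  have hca : cost (G (l - η) t l (l + η)) (l - η) ≤ η := by
    refine (hG.truthful₁ t l (l + η) (l - η) l).trans ((cost_le_of_mem hmem₂ _).trans_eq ?_)
    rw [sub_sub_cancel, abs_of_pos hη]
  have hmem₃ : l + η ∈ Set.range (G (l - η) t l (l + η)) :=
    hG.mem_of_lt_of_lt_of_lt hK h₃ h₂ (by linarith) (by linarith) (by linarith)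
  have hct := (hG.bounded (l - η) t l (l + η) l t η (by simp [abs_of_pos hη]) (by simp [hη.le])
    (by simp [hη.le]) (by simp [abs_of_pos hη])).2.1
  obtain ⟨y, hy, hyc⟩ := exists_mem_cost_eq (G (l - η) t l (l + η)) (l - η)
  obtain ⟨z, hz, hzc⟩ := exists_mem_cost_eq (G (l - η) t l (l + η)) t
  rw [← hyc, abs_le] at hca
  rw [← hzc, abs_le] at hct
  rcases eq_or_eq_or_eq_of_mem hy hz hmem₃ with h | h | h <;> linarith

end FourPlayerRule

/-! ### From clusters of agents to a contradiction -/

section Coalitions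

variable {ι : Type*} [DecidableEq ι] {F : (ι → ℝ) → Fin 2 → ℝ} {K : ℝ}

/-- No agent can lower her cost by misreporting her location. -/
def Truthful (F : (ι → ℝ) → Fin 2 → ℝ) : Prop :=
  ∀ (x : ι → ℝ) (i : ι) (t : ℝ), cost (F x) (x i) ≤ cost (F (Function.update x i t)) (x i)

/-- All costs are at most `K * δ` whenever two points are within `δ` of all the agents. -/
def ClusterBounded (K : ℝ) (F : (ι → ℝ) → Fin 2 → ℝ) : Prop :=
  ∀ (x : ι → ℝ) (p p' δ : ℝ), (∀ i, |x i - p| ≤ δ ∨ |x i - p'| ≤ δ) →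
    ∀ i, cost (F x) (x i) ≤ K * δ

/-- A coalition of agents with a common location cannot gain by a joint misreport. -/
lemma Truthful.coalition (hF : Truthful F) (S : Finset ι) :
    ∀ {x x' : ι → ℝ} {s : ℝ}, (∀ i ∈ S, x i = s) → (∀ i ∉ S, x i = x' i) →
      cost (F x) s ≤ cost (F x') s := by
  induction S using Finset.induction_on with
  | empty =>
    intro x x' s _ h
    rw [funext fun i => h i (Finset.notMem_empty i)]
  | insert j S hj ih =>
    intro x x' s hs h
    have h1 := hF x j (x' j)
    rw [hs j (Finset.mem_insert_self j S)] at h1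
    refine h1.trans (ih (fun i hi => ?_) fun i hi => ?_)
    · rw [Function.update_of_ne (ne_of_mem_of_not_mem hi hj)]
      exact hs i (Finset.mem_insert_of_mem hi)
    · rcases eq_or_ne i j with rfl | hij
      · rw [Function.update_self]
      · rw [Function.update_of_ne hij]
        exact h i (by simp [hij, hi])

/-- The locations when agent `o` is at `a`, agent `b` is at `w`, the agents in `T` are at `q`
and all the others are at `v`. -/
def clusters (o b : ι) (T : Finset ι) (a q w v : ℝ) : ι → ℝ := fun i =>
  if i = o then a else if i ∈ T then q else if i = b then w else v

lemma fourPlayerRule_clusters [Fintype ι] (hF : Truthful F) (hB : ClusterBounded K F) {o b e : ι}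
    {T : Finset ι} (hT : T.Nonempty) (hoT : o ∉ T) (hbo : b ≠ o) (hbT : b ∉ T) (heo : e ≠ o)
    (heT : e ∉ T) (heb : e ≠ b) :
    FourPlayerRule K fun a q w v => F (clusters o b T a q w v) where
  truthful₁ q w v x x' := hF.coalition {o} (by simp [clusters])
    (by intro i hi; rw [Finset.mem_singleton] at hi; simp [clusters, hi])
  truthful₂ a w v x x' := hF.coalition T
    (by
      intro i hi
      have : i ≠ o := ne_of_mem_of_not_mem hi hoT
      simp [clusters, hi, this])
    (by intro i hi; simp [clusters, hi])
  truthful₃ a q v x x' := hF.coalition {b} (by simp [clusters, hbo, hbT])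
    (by intro i hi; rw [Finset.mem_singleton] at hi; simp [clusters, hi])
  truthful₄ a q w x x' := hF.coalition {i | i ≠ o ∧ i ∉ T ∧ i ≠ b}
    (by
      intro i hi
      simp only [Finset.mem_filter, Finset.mem_univ, true_and] at hi
      simp [clusters, hi])
    (by
      intro i hi
      simp only [Finset.mem_filter, Finset.mem_univ, true_and] at hi
      unfold clusters
      split_ifs with h1 h2 h3 <;> first | rfl | exact absurd ⟨h1, h2, h3⟩ hi)
  bounded a q w v p p' δ ha hq hw hv := by
    have h := hB (clusters o b T a q w v) p p' δ (fun i => by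
      unfold clusters
      split_ifs <;> assumption)
    obtain ⟨j, hj⟩ := hT
    have hjo : j ≠ o := ne_of_mem_of_not_mem hj hoT
    refine ⟨?_, ?_, ?_⟩
    · simpa [clusters] using h o
    · simpa [clusters, hj, hjo] using h j
    · simpa [clusters, heo, heT, heb] using h e

/-- The key contradiction: a truthful cluster-bounded rule cannot always be closer to the large
cluster than the distinguished agent `o` is, when there is one further agent elsewhere. -/
theorem Truthful.false_of_cost_lt [Fintype ι] (hF : Truthful F) (hB : ClusterBounded K F)
    (hK : 0 ≤ K) (o : ι) (hcard : 3 ≤ Fintype.card ι)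
    (hlt : ∀ b ≠ o, ∀ a t c, a ≠ c → cost (F (clusters o b {b} a t t c)) c < |a - c|) :
    False := by
  have served : ∀ T : Finset ι, T.Nonempty → o ∉ T → (∃ e, e ≠ o ∧ e ∉ T) →
      ∀ b a t c, a < t → a < c → c ∈ Set.range (F (clusters o b T a t c c)) := by
    have base : ∀ b ≠ o, (∃ e, e ≠ o ∧ e ≠ b) → ∀ a t c, a < t → a < c →
        c ∈ Set.range (F (clusters o b {b} a t t c)) := by
      rintro b hbo ⟨e, heo, heb⟩ a t c hat hac
      have t₁ : ∀ t c, IsTruthful fun a => F (clusters o b {b} a t t c) := fun t c x x' =>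
        hF.coalition {o} (by simp [clusters])
          (by intro i hi; rw [Finset.mem_singleton] at hi; simp [clusters, hi])
      have t₃ : ∀ a t, IsTruthful fun c => F (clusters o b {b} a t t c) := fun a t x x' =>
        hF.coalition {i | i ≠ o ∧ i ≠ b}
          (by
            intro i hi
            simp only [Finset.mem_filter, Finset.mem_univ, true_and] at hi
            simp [clusters, hi])
          (by
            intro i hi
            simp only [Finset.mem_filter, Finset.mem_univ, true_and, not_and_or, not_not] at hi
            rcases hi with rfl | rfl <;> simp [clusters])
      have bd : ∀ a t c p p' δ, (|a - p| ≤ δ ∨ |a - p'| ≤ δ) → (|t - p| ≤ δ ∨ |t - p'| ≤ δ) →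
          (|c - p| ≤ δ ∨ |c - p'| ≤ δ) → cost (F (clusters o b {b} a t t c)) a ≤ K * δ ∧
            cost (F (clusters o b {b} a t t c)) t ≤ K * δ ∧
            cost (F (clusters o b {b} a t t c)) c ≤ K * δ := by
        intro a t c p p' δ ha ht hc
        have h := hB (clusters o b {b} a t t c) p p' δ (fun i => by
          unfold clusters
          split_ifs <;> assumption)
        refine ⟨?_, ?_, ?_⟩
        · simpa [clusters] using h o
        · simpa [clusters, hbo] using h b
        · simpa [clusters, heo, heb] using h e
      -- If `o` were served at `s`, the cluster at `c` would need a strictly nearer facility and the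
      -- distant `t` a third one.
      have close : ∀ s t c, 0 < |s - c| → (K + 2) * |s - c| < |t - s| →
          s ∉ Set.range (F (clusters o b {b} s t t c)) := by
        intro s t c hsc hst hs
        obtain ⟨y, hy, hyc⟩ := exists_mem_cost_eq (F (clusters o b {b} s t t c)) c
        obtain ⟨z, hz, hzc⟩ := exists_mem_cost_eq (F (clusters o b {b} s t t c)) t
        have h1 := hlt b hbo s t c (by rintro rfl; simp at hsc)
        have h2 := (bd s t c s t |s - c| (by simp) (by simp)
          (Or.inl (abs_sub_comm c s).le)).2.1
        rw [← hyc] at h1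
        rw [← hzc] at h2
        have h3 : ∀ r, |t - s| ≤ |r - t| + |r - s| := fun r => by
          have := abs_sub_le t r s
          rwa [abs_sub_comm t r] at this
        rcases eq_or_eq_or_eq_of_mem hs hy hz with h | h | h
        · rw [h] at h1; exact lt_irrefl _ (h ▸ h1)
        · rw [← h] at h2
          rw [abs_sub_comm t s] at hst
          linarith
        · have h4 := h3 z
          rw [h] at h1
          have h5 := abs_sub_le z c s
          rw [abs_sub_comm c s] at h5
          linarith
      by_contra hc
      rcases lt_trichotomy t c with htc | rfl | hct
      · obtain ⟨u, hu, hcu⟩ : ∃ u, u ∈ Set.range (F (clusters o b {b} a t t u)) ∧ c < u := by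
          set V := c + K * (t - a) + 1 with hV
          obtain ⟨y, hy, hyc⟩ := exists_mem_cost_eq (F (clusters o b {b} a t t V)) V
          have h := (bd a t V t V (t - a)
            (Or.inl (by rw [abs_sub_comm, abs_of_pos (by linarith)])) (by simp [hat.le])
            (by simp [hat.le])).2.2
          rw [← hyc, abs_le] at h
          exact ⟨y, (t₃ a t).mem_self hy, by linarith⟩
        obtain ⟨r, hcr, -, hr⟩ := (t₃ a t).exists_right_option hc hu hcu
        obtain ⟨η, hη, hη', hmem⟩ := hr ((r - t) / (K + 2)) (div_pos (by linarith) (by linarith))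
        rw [lt_div_iff₀ (by linarith)] at hη'
        refine close r t (r - η) ?_ ?_ ((t₁ t (r - η)).mem_self hmem)
        · rw [sub_sub_cancel, abs_of_pos hη]; exact hη
        · rw [sub_sub_cancel, abs_of_pos hη, abs_sub_comm, abs_of_pos (by linarith)]
          linarith
      · refine hc (mem_of_cost_le_zero ?_)
        simpa using (bd a t t a t 0 (by simp) (by simp) (by simp)).2.1
      · have ha : a ∈ Set.range (F (clusters o b {b} a t t a)) := by
          refine mem_of_cost_le_zero ?_
          simpa using (bd a t a a t 0 (by simp) (by simp) (by simp)).1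
        obtain ⟨l, hal, hlc, hl⟩ := (t₃ a t).exists_left_option hc ha hac
        obtain ⟨η, hη, hη', hmem⟩ := hl ((t - l) / (K + 2)) (div_pos (by linarith) (by linarith))
        rw [lt_div_iff₀ (by linarith)] at hη'
        refine close l t (l + η) ?_ ?_ ((t₁ t (l + η)).mem_self hmem)
        · rw [sub_add_cancel_left, abs_neg, abs_of_pos hη]; exact hη
        · rw [sub_add_cancel_left, abs_neg, abs_of_pos hη, abs_of_pos (by linarith)]
          linarith
    have single : ∀ b a t w c, clusters o b {b} a t w c = clusters o b {b} a t t c := by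
      intro b a t w c
      ext i
      by_cases h : i = b <;> simp [clusters, h]
    have irrel : ∀ b b' T a t c, clusters o b T a t c c = clusters o b' T a t c c := by
      intro b b' T a t c
      ext i
      simp only [clusters, ite_self]
    intro T
    induction T using Finset.induction_on with
    | empty => simp
    | insert b T hbT ih =>
      intro _ ho he b' a t c hat hac
      rw [irrel b' b]
      obtain ⟨e, heo, heT⟩ := he
      simp only [Finset.mem_insert, not_or] at ho heT
      rcases T.eq_empty_or_nonempty with rfl | hT
      · rw [insert_empty_eq, single]
        exact base b (Ne.symm ho.1) ⟨e, heo, heT.1⟩ a t c hat hac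
      -- With `b` still in the last cluster this is the induction hypothesis; with only `b` outside
      -- it, `base`.
      · have key := (fourPlayerRule_clusters hF hB hT ho.2 (Ne.symm ho.1) hbT heo heT.2
          heT.1).mem_of_agree hK
          (fun a q v h1 h2 => ih hT ho.2 ⟨e, heo, heT.2⟩ b a q v h1 h2)
          (fun a w v h1 h2 => by
            have := base b (Ne.symm ho.1) ⟨e, heo, heT.1⟩ a w v h1 h2
            convert this using 3
            ext i
            unfold clusters
            by_cases h : i = b
            · subst h; simp [hbT]
            · simp [h]) hat hac
        convert key using 3
        ext i
        unfold clusters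
        by_cases h : i = b
        · subst h; simp [hbT]
        · simp [h]
  obtain ⟨b, hbo⟩ : ∃ b, b ≠ o := by
    have : Nontrivial ι := Fintype.one_lt_card_iff_nontrivial.1 (by omega)
    exact exists_ne o
  obtain ⟨e, heo, heb⟩ : ∃ e, e ≠ o ∧ e ≠ b := by
    by_contra! h
    have : (Finset.univ : Finset ι) ⊆ {o, b} := fun i _ => by
      by_cases hi : i = o
      · simp [hi]
      · simp [h i hi]
    have := (Finset.card_le_card this).trans Finset.card_le_two
    rw [Finset.card_univ] at this
    omega
  set δ : ℝ := 1 / (K + 2) with hδ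
  have hδ0 : 0 < δ := div_pos one_pos (by linarith)
  have hδK : (K + 2) * δ = 1 := by rw [hδ]; field_simp
  -- Both clusters are served, so the facilities are `1` and `1 + δ`, although the cost of `o` at
  -- `0` is at most `K * δ < 1`.
  set x := clusters o b {b} 0 (1 + δ) 1 1 with hx
  have h1 : (1 : ℝ) ∈ Set.range (F x) :=
    served {b} (by simp) (by simpa using hbo.symm) ⟨e, heo, by simpa using heb⟩ b 0 (1 + δ) 1
      (by linarith) one_pos
  have h2 : 1 + δ ∈ Set.range (F x) := by
    have := served {i | i ≠ o ∧ i ≠ b} ⟨e, by simp [heo, heb]⟩ (by simp)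
      ⟨b, hbo, by simp⟩ b 0 1 (1 + δ) one_pos (by linarith)
    convert this using 3
    rw [hx]
    ext i
    unfold clusters
    by_cases ho : i = o
    · simp [ho]
    · by_cases hb : i = b <;> simp [ho, hb]
  have h3 := hB x 0 1 δ (fun i => by
    rw [hx]
    unfold clusters
    split_ifs <;> simp [hδ0.le, abs_of_pos hδ0]) o
  have hxo : x o = 0 := by simp [hx, clusters]
  rw [hxo] at h3
  obtain ⟨y, hy, hyc⟩ := exists_mem_cost_eq (F x) 0
  rw [← hyc, abs_le] at h3
  rcases eq_or_eq_or_eq_of_mem h1 h2 hy with h | h | h <;> linarith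

end Coalitions

/-! ### Two-group profiles and the approximation ratio -/

section Mechanisms

variable {n m : ℕ} {w : Fin m → ℝ} {θ : Profile n m}

lemma weightedTotalGroupCost_le_maxGroupEffect (w : Fin m → ℝ) (θ : Profile n m)
    (y : Fin 2 → ℝ) (j : Fin m) : weightedTotalGroupCost w θ y j ≤ maxGroupEffect w θ y :=
  le_ciSup (Set.finite_range fun j => weightedTotalGroupCost w θ y j).bddAbove j

lemma weightedTotalGroupCost_nonneg (hw : ∀ j, 0 < w j) (y : Fin 2 → ℝ) (j : Fin m) :
    0 ≤ weightedTotalGroupCost w θ y j :=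
  mul_nonneg (hw j).le (Finset.sum_nonneg fun _ _ => cost_nonneg _ _)

lemma optMaxGroupEffect_le (hw : ∀ j, 0 < w j) (y : Fin 2 → ℝ) :
    optMaxGroupEffect 2 w θ ≤ maxGroupEffect w θ y :=
  ciInf_le ⟨0, by
    rintro _ ⟨y, rfl⟩
    exact Real.iSup_nonneg fun j => weightedTotalGroupCost_nonneg hw y j⟩ y

lemma optMaxGroupEffect_nonneg (hw : ∀ j, 0 < w j) : 0 ≤ optMaxGroupEffect 2 w θ :=
  Real.iInf_nonneg fun y => Real.iSup_nonneg fun j => weightedTotalGroupCost_nonneg hw y j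

lemma maxGroupEffect_le_of_approxRatio_le {f : Mechanism n m 2} (hw : ∀ j, 0 < w j) {ρ : ℝ}
    (hρ : 0 ≤ ρ) (h : approxRatio w f ≤ ENNReal.ofReal ρ) (θ : Profile n m) :
    maxGroupEffect w θ (f θ) ≤ ρ * optMaxGroupEffect 2 w θ := by
  have h1 := (le_iSup (fun θ : Profile n m => ENNReal.ofReal (maxGroupEffect w θ (f θ)) /
    ENNReal.ofReal (optMaxGroupEffect 2 w θ)) θ).trans h
  have h2 : ENNReal.ofReal (maxGroupEffect w θ (f θ)) ≤
      ENNReal.ofReal ρ * ENNReal.ofReal (optMaxGroupEffect 2 w θ) := by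
    refine (ENNReal.div_le_iff_le_mul (Or.inr ENNReal.ofReal_ne_top)
      (Or.inl ENNReal.ofReal_ne_top)).1 h1
  rw [← ENNReal.ofReal_mul hρ] at h2
  exact (ENNReal.ofReal_le_ofReal_iff (mul_nonneg hρ (optMaxGroupEffect_nonneg hw))).1 h2

/-- The profile in which agent `o` belongs to group `p` only and all the others to group `q`
only. -/
def twoGroupProfile (o : Fin n) (p q : Fin m) (x : Fin n → ℝ) : Profile n m := fun i =>
  ⟨x i, if i = o then {p} else {q}⟩

variable {o : Fin n} {p q : Fin m}

lemma weightedTotalGroupCost_twoGroupProfile (hpq : p ≠ q) (x : Fin n → ℝ) (y : Fin 2 → ℝ)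
    (j : Fin m) : weightedTotalGroupCost w (twoGroupProfile o p q x) y j =
      if j = p then w p * cost y (x o)
      else if j = q then w q * ∑ i with i ≠ o, cost y (x i) else 0 := by
  unfold weightedTotalGroupCost
  split_ifs with h1 h2
  · subst h1
    congr 1
    rw [show ({i | j ∈ (twoGroupProfile o j q x i).groups} : Finset (Fin n)) = {o} by
      ext i
      rw [Finset.mem_filter]
      by_cases h : i = o <;> simp [twoGroupProfile, h, hpq]]
    simp [twoGroupProfile]
  · subst h2
    congr 1
    refine Finset.sum_congr ?_ fun i _ => rfl
    ext i
    rw [Finset.mem_filter, Finset.mem_filter]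
    by_cases h : i = o <;> simp [twoGroupProfile, h, h1]
  · rw [Finset.sum_eq_zero, mul_zero]
    intro i hi
    rw [Finset.mem_filter] at hi
    by_cases h : i = o <;> simp [twoGroupProfile, h, h1, h2] at hi

lemma truthful_twoGroupProfile {f : Mechanism n m 2} (hf : Strategyproof f) (o : Fin n)
    (p q : Fin m) : Truthful fun x => f (twoGroupProfile o p q x) := by
  intro x i t
  have h := hf (twoGroupProfile o p q x) i t
  have hup : Function.update (twoGroupProfile o p q x) i
      ⟨t, (twoGroupProfile o p q x i).groups⟩ =
      twoGroupProfile o p q (Function.update x i t) := by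
    ext1 k
    rcases eq_or_ne k i with rfl | hk
    · simp [twoGroupProfile]
    · simp [twoGroupProfile, hk]
  rwa [hup] at h

lemma clusterBounded_twoGroupProfile {f : Mechanism n m 2} (hw : ∀ j, 0 < w j) (hpq : p ≠ q)
    (hwpq : w p ≤ w q) {ρ : ℝ} (hρ : 0 ≤ ρ)
    (h : ∀ θ, maxGroupEffect w θ (f θ) ≤ ρ * optMaxGroupEffect 2 w θ) :
    ClusterBounded (ρ * (w q * n) / w p) fun x => f (twoGroupProfile o p q x) := by
  intro x s s' δ hx k
  set θ := twoGroupProfile o p q x with hθ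
  have hδ : 0 ≤ δ := by rcases hx o with h | h <;> exact (abs_nonneg _).trans h
  have hcost : ∀ i, cost ![s, s'] (x i) ≤ δ := by
    intro i
    rcases hx i with h | h
    · exact (cost_le_of_mem (y := s) ⟨0, rfl⟩ _).trans (by rwa [abs_sub_comm])
    · exact (cost_le_of_mem (y := s') ⟨1, rfl⟩ _).trans (by rwa [abs_sub_comm])
  have hn : (1 : ℝ) ≤ n := by
    have : 0 < n := o.pos
    exact_mod_cast this
  have hup : maxGroupEffect w θ ![s, s'] ≤ w q * n * δ := by
    have : Nonempty (Fin m) := ⟨p⟩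
    refine ciSup_le fun j => ?_
    rw [hθ, weightedTotalGroupCost_twoGroupProfile hpq]
    split_ifs
    · calc w p * cost ![s, s'] (x o) ≤ w q * δ :=
            mul_le_mul hwpq (hcost o) (cost_nonneg _ _) (hw q).le
        _ ≤ w q * n * δ := by
            have := mul_nonneg (hw q).le hδ
            nlinarith
    · rw [mul_assoc]
      refine mul_le_mul_of_nonneg_left ?_ (hw q).le
      refine (Finset.sum_le_card_nsmul _ _ δ fun i _ => hcost i).trans ?_
      rw [nsmul_eq_mul]
      refine mul_le_mul_of_nonneg_right ?_ hδ
      exact_mod_cast (Finset.card_le_univ _).trans_eq (Fintype.card_fin n)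
    · have := (hw q).le
      positivity
  have hlow : w p * cost (f θ) (x k) ≤ maxGroupEffect w θ (f θ) := by
    rcases eq_or_ne k o with rfl | hko
    · refine le_trans ?_ (weightedTotalGroupCost_le_maxGroupEffect w θ (f θ) p)
      rw [hθ, weightedTotalGroupCost_twoGroupProfile hpq, if_pos rfl]
    · refine le_trans ?_ (weightedTotalGroupCost_le_maxGroupEffect w θ (f θ) q)
      rw [hθ, weightedTotalGroupCost_twoGroupProfile hpq, if_neg hpq.symm, if_pos rfl]
      refine mul_le_mul hwpq ?_ (cost_nonneg _ _) (hw q).le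
      exact Finset.single_le_sum (f := fun i => cost (f (twoGroupProfile o p q x)) (x i))
        (fun i _ => cost_nonneg _ _) (by simpa using hko)
  have h1 : w p * cost (f θ) (x k) ≤ ρ * (w q * n * δ) :=
    hlow.trans ((h θ).trans (mul_le_mul_of_nonneg_left
      ((optMaxGroupEffect_le hw _).trans hup) hρ))
  change cost (f θ) (x k) ≤ _
  rw [div_mul_eq_mul_div, le_div_iff₀ (hw p)]
  linarith

lemma sum_cost_clusters {b : Fin n} (hbo : b ≠ o) (Y : Fin 2 → ℝ) (a t c : ℝ) :
    ∑ i with i ≠ o, cost Y (clusters o b {b} a t t c i) =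
      cost Y t + ((n : ℝ) - 2) * cost Y c := by
  have hb : b ∈ ({i | i ≠ o} : Finset (Fin n)) := by simpa using hbo
  rw [← Finset.add_sum_erase _ _ hb]
  congr 1
  · simp [clusters, hbo]
  · rw [Finset.sum_congr rfl (g := fun _ => cost Y c), Finset.sum_const, nsmul_eq_mul]
    · congr 1
      rw [Finset.card_erase_of_mem hb, Finset.filter_ne', Finset.card_erase_of_mem (by simp),
        Finset.card_fin]
      have h2 : 2 ≤ n := by
        have := Finset.card_le_univ ({o, b} : Finset (Fin n))
        rwa [Finset.card_pair hbo.symm, Fintype.card_fin] at this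
      rw [Nat.sub_sub, Nat.cast_sub h2]
      norm_num
    · intro i hi
      simp only [Finset.mem_erase, Finset.mem_filter, Finset.mem_univ, true_and] at hi
      simp [clusters, hi]

lemma cost_lt_of_ratio_lt {f : Mechanism n m 2} (hw : ∀ j, 0 < w j) (hpq : p ≠ q)
    (hn : 2 < n) {ρ : ℝ} (hρ : 0 ≤ ρ) (hρlt : ρ < 1 + ((n : ℝ) - 2) * (w q / w p))
    (h : ∀ θ, maxGroupEffect w θ (f θ) ≤ ρ * optMaxGroupEffect 2 w θ)
    {b : Fin n} (hbo : b ≠ o) {a t c : ℝ} (hac : a ≠ c) :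
    cost (f (twoGroupProfile o p q (clusters o b {b} a t t c))) c < |a - c| := by
  set θ := twoGroupProfile o p q (clusters o b {b} a t t c) with hθ
  set N : ℝ := (n : ℝ) - 2 with hN
  have hN0 : 0 < N := by
    have : (2 : ℝ) < n := by exact_mod_cast hn
    rw [hN]
    linarith
  have hp := hw p
  have hq := hw q
  set S : ℝ := w p + N * w q with hS
  have hS0 : 0 < S := by positivity
  set d := |a - c| with hd
  have hd0 : 0 < d := abs_pos.2 (sub_ne_zero.2 hac)
  -- With facilities at `t` and this weighted mean, both groups have effect at most `U`; the claimed
  -- ratio times `U` is exactly `w q * (N * d)`.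
  set s : ℝ := (w p * a + N * w q * c) / S with hs
  have hsa : |s - a| = N * w q / S * d := by
    rw [hd, abs_sub_comm a c, show s - a = N * w q / S * (c - a) by
      rw [hs]; field_simp; rw [hS]; ring, abs_mul, abs_of_pos (by positivity)]
  have hsc : |s - c| = w p / S * d := by
    rw [hd, show s - c = w p / S * (a - c) by
      rw [hs]; field_simp; rw [hS]; ring, abs_mul, abs_of_pos (by positivity)]
  set U : ℝ := w p * (N * w q / S * d) with hU
  have hU0 : 0 < U := by positivity
  have hup : maxGroupEffect w θ ![t, s] ≤ U := by
    have : Nonempty (Fin m) := ⟨p⟩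
    refine ciSup_le fun j => ?_
    rw [hθ, weightedTotalGroupCost_twoGroupProfile hpq, sum_cost_clusters hbo]
    split_ifs
    · rw [hU, ← hsa]
      refine mul_le_mul_of_nonneg_left ?_ hp.le
      simpa [clusters] using cost_le_of_mem (Y := ![t, s]) ⟨1, rfl⟩ a
    · rw [cost_eq_zero_of_mem (Y := ![t, s]) (y := t) ⟨0, rfl⟩, zero_add]
      have := cost_le_of_mem (Y := ![t, s]) (y := s) ⟨1, rfl⟩ c
      rw [hsc] at this
      calc w q * (N * cost ![t, s] c) ≤ w q * (N * (w p / S * d)) := by gcongr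
        _ = U := by rw [hU]; ring
    · exact hU0.le
  have hlow : w q * (N * cost (f θ) c) ≤ maxGroupEffect w θ (f θ) := by
    refine le_trans ?_ (weightedTotalGroupCost_le_maxGroupEffect w θ (f θ) q)
    rw [hθ, weightedTotalGroupCost_twoGroupProfile hpq, if_neg hpq.symm, if_pos rfl,
      sum_cost_clusters hbo]
    refine mul_le_mul_of_nonneg_left ?_ hq.le
    exact le_add_of_nonneg_left (cost_nonneg _ _)
  have h1 : w q * (N * cost (f θ) c) < w q * (N * d) := by
    calc w q * (N * cost (f θ) c) ≤ ρ * optMaxGroupEffect 2 w θ := hlow.trans (h θ)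
      _ ≤ ρ * U := mul_le_mul_of_nonneg_left ((optMaxGroupEffect_le hw _).trans hup) hρ
      _ < (1 + N * (w q / w p)) * U := mul_lt_mul_of_pos_right hρlt hU0
      _ = w q * (N * d) := by rw [hU]; field_simp; rw [hS]
  exact lt_of_mul_lt_mul_left (lt_of_mul_lt_mul_left h1 hq.le) hN0.le

lemma exists_ne_extremal_weights (hm : 2 ≤ m) (w : Fin m → ℝ) :
    ∃ p q, p ≠ q ∧ w p = wMin w ∧ w q = wMax w ∧ w p ≤ w q := by
  have : Nontrivial (Fin m) := Fin.nontrivial_iff_two_le.2 hm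
  obtain ⟨p, hp⟩ := exists_eq_ciInf_of_finite (f := w)
  obtain ⟨q, hq⟩ := exists_eq_ciSup_of_finite (f := w)
  have hle : ∀ j, w p ≤ w j := fun j => hp ▸ ciInf_le (Set.finite_range w).bddBelow j
  have hge : ∀ j, w j ≤ w q := fun j => hq ▸ le_ciSup (Set.finite_range w).bddAbove j
  rcases eq_or_ne p q with rfl | hpq
  · obtain ⟨r, hr⟩ := exists_ne p
    have hrp : w r = w p := le_antisymm (hge r) (hle r)
    exact ⟨p, r, hr.symm, hp, hrp.trans hq, hrp.ge⟩
  · exact ⟨p, q, hpq, hp, hq, hle q⟩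

end Mechanisms

end GroupFacility

theorem mainTheorem5 (n m : ℕ) (hn : 5 ≤ n) (hm : 2 ≤ m) (w : Fin m → ℝ) (hw : ∀ j, 0 < w j)
    (f : GroupFacility.Mechanism n m 2) (hf : GroupFacility.Strategyproof f) :
    ENNReal.ofReal
        (1 + ((n : ℝ) - 2) * (GroupFacility.wMax w / GroupFacility.wMin w)) ≤
      GroupFacility.approxRatio w f := by
  open GroupFacility in
  by_contra! hlt
  obtain ⟨p, q, hpq, hp, hq, hwpq⟩ := exists_ne_extremal_weights hm w
  rw [← hp, ← hq] at hlt
  set ρ := (approxRatio w f).toReal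
  have hle : approxRatio w f ≤ ENNReal.ofReal ρ := (ENNReal.ofReal_toReal hlt.ne_top).ge
  have hρ : 0 ≤ ρ := ENNReal.toReal_nonneg
  have hρlt : ρ < 1 + ((n : ℝ) - 2) * (w q / w p) :=
    ENNReal.toReal_lt_of_lt_ofReal hlt
  have hratio := maxGroupEffect_le_of_approxRatio_le hw hρ hle
  have hp0 := hw p
  have hq0 := hw q
  let o : Fin n := ⟨0, by omega⟩
  exact (truthful_twoGroupProfile hf o p q).false_of_cost_lt
    (clusterBounded_twoGroupProfile hw hpq hwpq hρ hratio) (by positivity) o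
    (by rw [Fintype.card_fin]; omega)
    fun b hbo a t c hac => cost_lt_of_ratio_lt hw hpq (by omega) hρ hρlt hratio hbo hac
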